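/- Let $F$ be a real Banach lattice, $E$ a real Banach space and $T:F\to E$ a bounded linear operator; write $\rho_T(f)=\|Tf\|$ and let $\mathrm{S}_F$ be the unit sphere of $F$. Subspaces are linear subspaces, not assumed closed unless this is said. A sequence $\{f_n\}\subset F$ is *disjoint* if $|f_m|\wedge|f_n|=0$ for all $m\ne n$ (zero terms are allowed), and a sequence $\{e_n\}\subset \mathrm{S}_F$ is *almost disjoint* if there is a disjoint sequence $\{f_n\}\subset F$ with $\|f_n-e_n\|\to 0$. A subspace of $F$ is *dispersed* if it contains no almost disjoint sequence, and *anti-dispersed* if it has no infinite-dimensional dispersed subspace. A bounded operator $R:X\to Y$ between normed spaces is *bounded from below* if there is $c>0$ with $\|Rx\|\ge c\|x\|$ for all $x\in X$; *strictly singular* if its restriction to any infinite-dimensional subspace of $X$ is not bounded from below; *upper semi-Fredholm (USF)* if its kernel is finite-dimensional and its range is closed. **Theorem.** The following conditions are equivalent (an operator $T$ satisfying them is called *disjointly non-singular*, DNS): 1. (a) no disjoint sequence $\{f_n\}\subset \mathrm{S}_F$ satisfies $\rho_T(f_n)\to 0$; equivalently, (b) no almost disjoint sequence $\{e_n\}\subset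 \mathrm{S}_F$ satisfies $\rho_T(e_n)\to 0$; 2. for every disjoint sequence $\{f_n\}\subset F$ with infinitely many nonzero terms, the restriction of $T$ to $\overline{\mathrm{span}}\{f_n\}_{n\in\mathbb{N}}$ is not compact; 3. for every disjoint sequence $\{f_n\}\subset F$ with infinitely many nonzero terms, the restriction of $T$ to $\overline{\mathrm{span}}\{f_n\}_{n\in\mathbb{N}}$ is not strictly singular; 4. for every disjoint sequence $\{f_n\}\subset F$, the restriction of $T$ to $\overline{\mathrm{span}}\{f_n\}_{n\in\mathbb{N}}$ is USF; 5. for every disjoint sequence $\{f_n\}\subset F$ there is $m\in\mathbb{N}$ such that the restriction of $T$ to $\overline{\mathrm{span}}\{f_n\}_{n\ge m}$ is bounded from below; 6. (a) $\ker(T-S)$ is dispersed for every compact operator $S:F\to E$; equivalently, (b) no compact operator $S:F\to E$ coincides with $T$ on a non-dispersed subspace of $F$; 7. the restriction of $T$ to every closed anti-dispersed subspace of $F$ is USF; 8. the restriction of $T$ to any non-dispersed subspace of $F$ is not compact; 9. the restriction of $T$ to any non-dispersed subspace of $F$ is not strictly singular. -/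

import Mathlib

/-- A sequence in a vector lattice is disjoint if its terms are pairwise disjoint:
`|f m| ∧ |f n| = 0` for `m ≠ n`. Zero terms are allowed. -/
def IsDisjointSeq {F : Type*} [AddGroup F] [Lattice F] (f : ℕ → F) : Prop :=
  ∀ m n, m ≠ n → |f m| ⊓ |f n| = 0

/-- A sequence of unit vectors is almost disjoint if it is asymptotically close in norm to some
disjoint sequence. -/
def IsAlmostDisjointSeq {F : Type*} [NormedAddCommGroup F] [Lattice F] (e : ℕ → F) : Prop :=
  (∀ n, ‖e n‖ = 1) ∧
    ∃ f : ℕ → F, IsDisjointSeq f ∧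
      Filter.Tendsto (fun n => ‖f n - e n‖) Filter.atTop (nhds 0)

/-- A linear subspace (not necessarily closed) is dispersed if it contains no almost disjoint
sequence. -/
def IsDispersed {F : Type*} [NormedAddCommGroup F] [NormedSpace ℝ F] [Lattice F]
    (H : Submodule ℝ F) : Prop :=
  ¬ ∃ e : ℕ → F, IsAlmostDisjointSeq e ∧ ∀ n, e n ∈ H

/-- A linear subspace is anti-dispersed if it has no infinite-dimensional dispersed subspace. -/
def IsAntiDispersed {F : Type*} [NormedAddCommGroup F] [NormedSpace ℝ F] [Lattice F]
    (H : Submodule ℝ F) : Prop :=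
  ∀ G : Submodule ℝ F, G ≤ H → ¬ FiniteDimensional ℝ G → ¬ IsDispersed G

/-- `T` is bounded from below: `c ‖x‖ ≤ ‖T x‖` for some `c > 0` and all `x`. -/
def IsBoundedFromBelow {X Y : Type*} [NormedAddCommGroup X] [NormedSpace ℝ X]
    [NormedAddCommGroup Y] [NormedSpace ℝ Y] (T : X →L[ℝ] Y) : Prop :=
  ∃ c : ℝ, 0 < c ∧ ∀ x, c * ‖x‖ ≤ ‖T x‖

/-- `T` is strictly singular: no restriction of `T` to an infinite-dimensional subspace is bounded
from below. -/
def IsStrictlySingular {X Y : Type*} [NormedAddCommGroup X] [NormedSpace ℝ X]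
    [NormedAddCommGroup Y] [NormedSpace ℝ Y] (T : X →L[ℝ] Y) : Prop :=
  ∀ G : Submodule ℝ X, ¬ FiniteDimensional ℝ G → ¬ IsBoundedFromBelow (T.domRestrict G)

/-- `T` is upper semi-Fredholm: its kernel is finite-dimensional and its range is closed. -/
def IsUpperSemiFredholm {X Y : Type*} [NormedAddCommGroup X] [NormedSpace ℝ X]
    [NormedAddCommGroup Y] [NormedSpace ℝ Y] (T : X →L[ℝ] Y) : Prop :=
  FiniteDimensional ℝ (LinearMap.ker (T : X →ₗ[ℝ] Y)) ∧ IsClosed (Set.range T)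

/-- The closed linear span of a set. -/
def closedSpan {X : Type*} [NormedAddCommGroup X] [NormedSpace ℝ X] (s : Set X) :
    Submodule ℝ X :=
  (Submodule.span ℝ s).topologicalClosure

/-! ### Disjointness in vector lattices -/

section Lattice

/-! Two constructions tie the conditions together. The first is a gliding hump: successive blocks of
a disjoint sequence are disjoint, so unit vectors taken from ever later tails of its closed span can
be approximated by blocks and form an almost disjoint sequence
(`IsDisjointSeq.exists_isAlmostDisjointSeq`). Hence failure of a lower bound on every tail produces
an almost disjoint sequence on which `T` tends to zero, and closed spans of disjoint sequences are
anti-dispersed.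

The second is a nuclear series. Solidity of the norm gives a disjoint sequence biorthogonal
functionals of norm at most `‖f n‖⁻¹` (`IsDisjointSeq.exists_dual`), so small prescribed values on
it are attained by a compact operator of small norm (`exists_isCompactOperator_apply_eq`). Applied
to the values `T (f n)`, this makes `T` agree with a compact operator on a subsequence; applied to
`e n - f n`, it carries lower bounds from a disjoint sequence to a nearby almost disjoint one
(`not_isStrictlySingular_of_not_isDispersed`).

The anti-dispersed condition also uses a lattice-free fact: an operator that is not upper
semi-Fredholm has a compact restriction to an infinite-dimensional subspace. -/

theorem IsDisjointSeq.comp_injective {F : Type*} [AddGroup F] [Lattice F] {f : ℕ → F} (hf : IsDisjointSeq f) {φ : ℕ → ℕ}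
    (hφ : Function.Injective φ) : IsDisjointSeq (f ∘ φ) :=
  fun _ _ h => hf _ _ (hφ.ne h)

variable {F : Type*} [Lattice F] [AddCommGroup F] [IsOrderedAddMonoid F]

/-- Distributing addition over the infima turns the right side into the infimum of `a + a`, `b + a`,
`a + c` and `b + c`; the first three dominate `a`. -/
theorem inf_add_le_inf_add_inf {a b c : F} (ha : 0 ≤ a) (hb : 0 ≤ b) (hc : 0 ≤ c) :
    a ⊓ (b + c) ≤ a ⊓ b + a ⊓ c := by
  rw [add_inf, inf_add, inf_add]
  refine le_inf (le_inf ?_ ?_) (le_inf ?_ ?_)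
  · exact inf_le_left.trans (le_add_of_nonneg_left ha)
  · exact inf_le_left.trans (le_add_of_nonneg_left hb)
  · exact inf_le_left.trans (le_add_of_nonneg_right hc)
  · exact inf_le_right

theorem abs_inf_abs_add_eq_zero {x y z : F} (hy : |x| ⊓ |y| = 0) (hz : |x| ⊓ |z| = 0) :
    |x| ⊓ |y + z| = 0 := by
  refine le_antisymm ?_ (le_inf (abs_nonneg _) (abs_nonneg _))
  calc |x| ⊓ |y + z| ≤ |x| ⊓ (|y| + |z|) := inf_le_inf_left _ (abs_add_le _ _)
    _ ≤ |x| ⊓ |y| + |x| ⊓ |z| :=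
      inf_add_le_inf_add_inf (abs_nonneg _) (abs_nonneg _) (abs_nonneg _)
    _ = 0 := by rw [hy, hz, add_zero]

/-- From `u = (u + v) - v`, `|u|` lies below `|u + v| + |v|`, and the `|v|` part contributes nothing
after meeting with `|u|`. -/
theorem abs_le_abs_add_of_disjoint {u v : F} (h : |u| ⊓ |v| = 0) : |u| ≤ |u + v| := by
  calc |u| ≤ |u| ⊓ (|u + v| + |v|) := by
        refine le_inf le_rfl ?_
        calc |u| = |(u + v) + -v| := by simp
          _ ≤ |u + v| + |v| := (abs_add_le _ _).trans (by rw [abs_neg])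
    _ ≤ |u| ⊓ |u + v| + |u| ⊓ |v| :=
      inf_add_le_inf_add_inf (abs_nonneg _) (abs_nonneg _) (abs_nonneg _)
    _ = |u| ⊓ |u + v| := by rw [h, add_zero]
    _ ≤ |u + v| := inf_le_right

variable [Module ℝ F] [IsOrderedModule ℝ F]

theorem abs_inf_abs_smul_eq_zero {x y : F} (h : |x| ⊓ |y| = 0) (c : ℝ) :
    |x| ⊓ |c • y| = 0 := by
  refine le_antisymm ?_ (le_inf (abs_nonneg _) (abs_nonneg _))
  -- This `d` dominates both `1` and `|c|`, so dividing by it puts the infimum below `|x|` and `|y|`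
  -- at once.
  set d : ℝ := |c| + 1 with hd
  have hc0 := abs_nonneg c
  have hd1 : 1 ≤ d := by linarith
  have hd0 : 0 < d := by linarith
  have hcy : |c • y| ≤ |c| • |y| := by
    refine abs_le'.2 ⟨?_, ?_⟩
    · rcases le_total 0 c with hc | hc
      · rw [abs_of_nonneg hc]; exact smul_le_smul_of_nonneg_left (le_abs_self _) hc
      · rw [abs_of_nonpos hc, ← neg_smul_neg]
        exact smul_le_smul_of_nonneg_left (neg_le_abs _) (neg_nonneg.2 hc)
    · rcases le_total 0 c with hc | hc
      · rw [abs_of_nonneg hc, ← smul_neg]; exact smul_le_smul_of_nonneg_left (neg_le_abs _) hc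
      · rw [abs_of_nonpos hc, ← neg_smul]
        exact smul_le_smul_of_nonneg_left (le_abs_self _) (neg_nonneg.2 hc)
  have hcd : |c| • |y| ≤ d • |y| := smul_le_smul_of_nonneg_right (by linarith) (abs_nonneg _)
  have hx : |x| ≤ d • |x| := by
    simpa using smul_le_smul_of_nonneg_right hd1 (abs_nonneg x)
  have key : d⁻¹ • (|x| ⊓ |c • y|) ≤ |x| ⊓ |y| := by
    refine le_inf ?_ ?_
    · have := smul_le_smul_of_nonneg_left ((inf_le_left : |x| ⊓ |c • y| ≤ _).trans hx)
        (inv_nonneg.2 hd0.le)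
      rwa [inv_smul_smul₀ hd0.ne'] at this
    · have := smul_le_smul_of_nonneg_left
        (((inf_le_right : |x| ⊓ |c • y| ≤ _).trans hcy).trans hcd) (inv_nonneg.2 hd0.le)
      rwa [inv_smul_smul₀ hd0.ne'] at this
  rw [h] at key
  have := smul_le_smul_of_nonneg_left key hd0.le
  rwa [smul_inv_smul₀ hd0.ne', smul_zero] at this

/-- The disjoint complement of an element of a vector lattice. -/
def disjointCompl (x : F) : Submodule ℝ F where
  carrier := {y | |x| ⊓ |y| = 0}
  add_mem' := abs_inf_abs_add_eq_zero
  zero_mem' := by simp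
  smul_mem' c _ h := abs_inf_abs_smul_eq_zero h c

theorem mem_disjointCompl {x y : F} : y ∈ disjointCompl x ↔ |x| ⊓ |y| = 0 := Iff.rfl

theorem mem_disjointCompl_comm {x y : F} : y ∈ disjointCompl x ↔ x ∈ disjointCompl y := by
  rw [mem_disjointCompl, mem_disjointCompl, inf_comm]

theorem span_le_disjointCompl {x : F} {s : Set F} (h : ∀ y ∈ s, |x| ⊓ |y| = 0) :
    Submodule.span ℝ s ≤ disjointCompl x :=
  Submodule.span_le.2 h

theorem IsDisjointSeq.inf_abs_eq_zero_of_mem_span {f : ℕ → F} (hf : IsDisjointSeq f)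
    {A B : Set ℕ} (hAB : Disjoint A B) {x y : F} (hx : x ∈ Submodule.span ℝ (f '' A))
    (hy : y ∈ Submodule.span ℝ (f '' B)) : |x| ⊓ |y| = 0 := by
  refine span_le_disjointCompl (x := x) (s := f '' B) ?_ hy
  rintro _ ⟨b, hb, rfl⟩
  refine mem_disjointCompl_comm.1 (span_le_disjointCompl (x := f b) (s := f '' A) ?_ hx)
  rintro _ ⟨a, ha, rfl⟩
  exact hf b a fun h => Set.disjoint_left.1 hAB ha (h ▸ hb)

theorem IsDisjointSeq.smul {f : ℕ → F} (hf : IsDisjointSeq f) (c : ℕ → ℝ) :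
    IsDisjointSeq fun n => c n • f n := fun m n h => by
  refine abs_inf_abs_smul_eq_zero ?_ _
  rw [inf_comm]
  refine abs_inf_abs_smul_eq_zero ?_ _
  rw [inf_comm]
  exact hf m n h

/-- Block sequences of a disjoint sequence are disjoint. -/
theorem IsDisjointSeq.exists_block {f : ℕ → F} (hf : IsDisjointSeq f) (Q : ℕ → F → Prop)
    (h : ∀ m k, ∃ m', m ≤ m' ∧ ∃ y ∈ Submodule.span ℝ (f '' Set.Ico m m'), Q k y) :
    ∃ y : ℕ → F, IsDisjointSeq y ∧ ∀ k, Q k (y k) := by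
  choose M hM y hy hQ using h
  -- `g k` is the left end of the `k`-th block; blocks may be empty, so `g` is only monotone.
  let g : ℕ → ℕ := fun n => Nat.rec 0 (fun k m => M m k) n
  have hg : Monotone g := monotone_nat_of_le_succ fun k => hM (g k) k
  have hyg : ∀ k, y (g k) k ∈ Submodule.span ℝ (f '' Set.Ico (g k) (g (k + 1))) :=
    fun k => hy (g k) k
  refine ⟨fun k => y (g k) k, fun m n hmn => ?_, fun k => hQ _ _⟩
  exact hf.inf_abs_eq_zero_of_mem_span (hg.pairwise_disjoint_on_Ico_succ hmn) (hyg m) (hyg n)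

end Lattice

/-! ### Closed spans and their tails -/

section Span

theorem exists_mem_span_image_Ico {X : Type*} [AddCommGroup X] [Module ℝ X] {f : ℕ → X} {m : ℕ}
    {x : X} (hx : x ∈ Submodule.span ℝ (f '' {n | m ≤ n})) :
    ∃ m', m ≤ m' ∧ x ∈ Submodule.span ℝ (f '' Set.Ico m m') := by
  induction hx using Submodule.span_induction with
  | mem x hx =>
    obtain ⟨n, hn, rfl⟩ := hx
    exact ⟨n + 1, Nat.le_succ_of_le hn, Submodule.subset_span ⟨n, ⟨hn, n.lt_succ_self⟩, rfl⟩⟩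
  | zero => exact ⟨m, le_rfl, Submodule.zero_mem _⟩
  | add x y _ _ hx hy =>
    obtain ⟨a, ha, hx⟩ := hx
    obtain ⟨b, hb, hy⟩ := hy
    refine ⟨max a b, ha.trans (le_max_left _ _), Submodule.add_mem _ ?_ ?_⟩
    · exact Submodule.span_mono (Set.image_mono (Set.Ico_subset_Ico_right (le_max_left _ _))) hx
    · exact Submodule.span_mono (Set.image_mono (Set.Ico_subset_Ico_right (le_max_right _ _))) hy
  | smul c x _ hx =>
    obtain ⟨a, ha, hx⟩ := hx
    exact ⟨a, ha, Submodule.smul_mem _ _ hx⟩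

variable {X : Type*} [NormedAddCommGroup X] [NormedSpace ℝ X]

theorem subset_closedSpan (s : Set X) : s ⊆ closedSpan s :=
  Submodule.subset_span.trans (Submodule.le_topologicalClosure _)

theorem isClosed_closedSpan (s : Set X) : IsClosed (closedSpan s : Set X) :=
  Submodule.isClosed_topologicalClosure _

theorem closedSpan_le {s : Set X} {H : Submodule ℝ X} (hH : IsClosed (H : Set X)) (h : s ⊆ H) :
    closedSpan s ≤ H :=
  Submodule.topologicalClosure_minimal _ (Submodule.span_le.2 h) hH

/-- The closed span of a sequence is the sum of a finite-dimensional space and that of a tail. -/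
theorem closedSpan_range_eq_sup (f : ℕ → X) (m : ℕ) :
    closedSpan (Set.range f) =
      Submodule.span ℝ (f '' {n | n < m}) ⊔ closedSpan (f '' {n | m ≤ n}) := by
  have hfin : FiniteDimensional ℝ (Submodule.span ℝ (f '' {n | n < m})) :=
    FiniteDimensional.span_of_finite ℝ ((Set.finite_lt_nat m).image f)
  refine le_antisymm (closedSpan_le ?_ ?_) (sup_le ?_ ?_)
  · rw [sup_comm]
    exact Submodule.isClosed_sup_finiteDimensional _ _ (isClosed_closedSpan _)
  · rintro _ ⟨n, rfl⟩
    rcases lt_or_ge n m with h | h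
    · exact Submodule.mem_sup_left (Submodule.subset_span ⟨n, h, rfl⟩)
    · exact Submodule.mem_sup_right (subset_closedSpan _ ⟨n, h, rfl⟩)
  · exact Submodule.span_le.2 ((Set.image_subset_range _ _).trans (subset_closedSpan _))
  · exact closedSpan_le (isClosed_closedSpan _)
      ((Set.image_subset_range _ _).trans (subset_closedSpan _))

/-- Vectors of the closed span of a tail are approximated by vectors of blocks. -/
theorem exists_mem_span_image_Ico_norm_sub_lt {f : ℕ → X} {m : ℕ} {x : X}
    (hx : x ∈ closedSpan (f '' {n | m ≤ n})) {ε : ℝ} (hε : 0 < ε) :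
    ∃ m', m ≤ m' ∧ ∃ y ∈ Submodule.span ℝ (f '' Set.Ico m m'), ‖y - x‖ < ε := by
  obtain ⟨y, hy, hxy⟩ := Metric.mem_closure_iff.1 hx ε hε
  obtain ⟨m', hm, hy'⟩ := exists_mem_span_image_Ico hy
  exact ⟨m', hm, y, hy', by rwa [← dist_eq_norm, dist_comm]⟩

/-- If `G` met `W` trivially, it would embed into the image of `V` in `X ⧸ W`, which is
finite-dimensional. -/
theorem exists_ne_zero_mem_inf {G V W : Submodule ℝ X} (hG : ¬ FiniteDimensional ℝ G)
    [FiniteDimensional ℝ V] (h : G ≤ V ⊔ W) : ∃ x ∈ G, x ∈ W ∧ x ≠ 0 := by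
  by_contra! hne
  apply hG
  have hW : FiniteDimensional ℝ (V.map W.mkQ) := inferInstance
  have hmap : ∀ x : G, W.mkQ x ∈ V.map W.mkQ := fun x => by
    obtain ⟨v, hv, w, hw, hvw⟩ := Submodule.mem_sup.1 (h x.2)
    refine ⟨v, hv, ?_⟩
    rw [← hvw, map_add, (Submodule.Quotient.mk_eq_zero W).2 hw |> fun h => (h : W.mkQ w = 0),
      add_zero]
  refine FiniteDimensional.of_injective
    (((W.mkQ).comp G.subtype).codRestrict (V.map W.mkQ) hmap) ?_
  rw [← LinearMap.ker_eq_bot, LinearMap.ker_eq_bot']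
  intro x hx
  have h0 : W.mkQ (x : X) = 0 := congrArg Subtype.val hx
  exact Subtype.ext (hne x x.2 ((Submodule.Quotient.mk_eq_zero W).1 h0))

end Span

/-! ### Compact, strictly singular and upper semi-Fredholm operators -/

section Operators

variable {X Y : Type*} [NormedAddCommGroup X] [NormedSpace ℝ X]
  [NormedAddCommGroup Y] [NormedSpace ℝ Y]

/-- A bounded from below compact operator has finite-dimensional domain. -/
theorem IsBoundedFromBelow.finiteDimensional_of_isCompactOperator {T : X →L[ℝ] Y}
    (hT : IsBoundedFromBelow T) (hc : IsCompactOperator T) : FiniteDimensional ℝ X := by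
  by_contra hX
  obtain ⟨c, hc0, hcT⟩ := hT
  -- Riesz's lemma gives a bounded 1-separated sequence; its image is `c`-separated, so no
  -- subsequence of it converges.
  obtain ⟨R, f, -, hfR, hf⟩ := exists_seq_norm_le_one_le_norm_sub (𝕜 := ℝ) (E := X) hX
  obtain ⟨K, hK, hKT⟩ :=
    IsCompactOperator.image_closedBall_subset_compact (f := (T : X →ₗ[ℝ] Y)) hc R
  obtain ⟨y, -, φ, hφ, hy⟩ := hK.tendsto_subseq (x := fun n => T (f n)) fun n =>
    hKT ⟨f n, by simpa using hfR n, rfl⟩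
  obtain ⟨N, hN⟩ := Metric.cauchySeq_iff.1 hy.cauchySeq c hc0
  have h1 := hN N le_rfl (N + 1) N.le_succ
  have h2 : (1 : ℝ) ≤ ‖f (φ N) - f (φ (N + 1))‖ := hf (hφ.injective.ne N.lt_succ_self.ne)
  have h3 := hcT (f (φ N) - f (φ (N + 1)))
  simp only [Function.comp_apply, dist_eq_norm] at h1
  rw [map_sub] at h3
  nlinarith

theorem IsCompactOperator.domRestrict {T : X →L[ℝ] Y} (hT : IsCompactOperator T)
    (H : Submodule ℝ X) : IsCompactOperator (T.domRestrict H) :=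
  hT.comp_clm H.subtypeL

theorem IsCompactOperator.domRestrict_of_eqOn {S T : X →L[ℝ] Y} (hS : IsCompactOperator S)
    {H : Submodule ℝ X} (h : ∀ x ∈ H, S x = T x) : IsCompactOperator (T.domRestrict H) := by
  have : T.domRestrict H = S.domRestrict H := ContinuousLinearMap.ext fun x => (h x x.2).symm
  rw [this]
  exact hS.domRestrict H

theorem IsCompactOperator.isStrictlySingular {T : X →L[ℝ] Y} (hT : IsCompactOperator T) :
    IsStrictlySingular T := fun G hG hb =>
  hG (hb.finiteDimensional_of_isCompactOperator (hT.domRestrict G))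

theorem IsStrictlySingular.finiteDimensional_of_le {T : X →L[ℝ] Y} {G H : Submodule ℝ X}
    (hT : IsStrictlySingular (T.domRestrict H)) (hGH : G ≤ H)
    (hG : IsBoundedFromBelow (T.domRestrict G)) : FiniteDimensional ℝ G := by
  by_contra hfin
  refine hT (G.comap H.subtype) (fun h => hfin ?_) ?_
  · exact LinearEquiv.finiteDimensional (Submodule.comapSubtypeEquivOfLe hGH)
  · obtain ⟨c, hc, h⟩ := hG
    exact ⟨c, hc, fun x => h ⟨x.1.1, x.2⟩⟩

theorem exists_norm_eq_one_of_not_isBoundedFromBelow {T : X →L[ℝ] Y} {W : Submodule ℝ X}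
    (h : ¬ IsBoundedFromBelow (T.domRestrict W)) {ε : ℝ} (hε : 0 < ε) :
    ∃ x ∈ W, ‖x‖ = 1 ∧ ‖T x‖ < ε := by
  by_contra! hne
  refine h ⟨ε, hε, fun x => ?_⟩
  rcases eq_or_ne x 0 with rfl | hx
  · simp
  have hx0 : 0 < ‖(x : X)‖ := norm_pos_iff.2 fun h => hx (Subtype.ext h)
  have := hne (‖(x : X)‖⁻¹ • (x : X)) (W.smul_mem _ x.2)
    (by rw [norm_smul, norm_inv, norm_norm, inv_mul_cancel₀ hx0.ne'])
  rw [map_smul, norm_smul, norm_inv, norm_norm, inv_mul_eq_div, le_div_iff₀ hx0] at this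
  exact this

theorem isClosed_map_of_isBoundedFromBelow [CompleteSpace X] {T : X →L[ℝ] Y}
    {W : Submodule ℝ X} (hW : IsClosed (W : Set X)) (h : IsBoundedFromBelow (T.domRestrict W)) :
    IsClosed (W.map (T : X →ₗ[ℝ] Y) : Set Y) := by
  have : CompleteSpace W := hW.completeSpace_coe
  obtain ⟨c, hc, h⟩ := h
  have hanti : AntilipschitzWith (Real.toNNReal c⁻¹) (T.domRestrict W) := by
    refine AddMonoidHomClass.antilipschitz_of_bound _ fun x => ?_
    rw [Real.coe_toNNReal _ (inv_nonneg.2 hc.le), inv_mul_eq_div, le_div_iff₀ hc, mul_comm]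
    exact h x
  have := hanti.isClosed_range (T.domRestrict W).uniformContinuous
  convert this using 1
  ext y
  simp

/-- An operator which is bounded from below on a closed subspace of finite codimension is upper
semi-Fredholm. -/
theorem isUpperSemiFredholm_of_eq_sup [CompleteSpace X] {T : X →L[ℝ] Y}
    {H V W : Submodule ℝ X} [FiniteDimensional ℝ V] (hW : IsClosed (W : Set X)) (hH : H = V ⊔ W)
    (h : IsBoundedFromBelow (T.domRestrict W)) : IsUpperSemiFredholm (T.domRestrict H) := by
  constructor
  · by_contra hker
    set K : Submodule ℝ X :=
      (LinearMap.ker (T.domRestrict H : H →ₗ[ℝ] Y)).map H.subtype with hK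
    have hK' : ¬ FiniteDimensional ℝ K := fun hfin =>
      hker (LinearEquiv.finiteDimensional
        (Submodule.equivMapOfInjective H.subtype H.injective_subtype _).symm)
    obtain ⟨x, hxK, hxW, hx⟩ := exists_ne_zero_mem_inf (V := V) (W := W) hK'
      (hH ▸ Submodule.map_subtype_le _ _)
    obtain ⟨c, hc, h⟩ := h
    obtain ⟨z, hz, rfl⟩ := hxK
    have hT : T (z : X) = 0 := hz
    have := h ⟨z, hxW⟩
    have h2 : c * ‖(z : X)‖ ≤ ‖T (z : X)‖ := this
    rw [hT, norm_zero] at h2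
    have h3 : 0 < ‖(z : X)‖ := norm_pos_iff.2 hx
    nlinarith
  · have h1 := isClosed_map_of_isBoundedFromBelow hW h
    have h2 := Submodule.isClosed_sup_finiteDimensional (W.map (T : X →ₗ[ℝ] Y))
      (V.map (T : X →ₗ[ℝ] Y)) h1
    rw [sup_comm, ← Submodule.map_sup, ← hH] at h2
    convert h2 using 1
    ext y
    simp

/-- An upper semi-Fredholm operator on an infinite-dimensional Banach space is not strictly
singular. -/
theorem IsUpperSemiFredholm.not_isStrictlySingular [CompleteSpace X] [CompleteSpace Y]
    {T : X →L[ℝ] Y} (hT : IsUpperSemiFredholm T) (hX : ¬ FiniteDimensional ℝ X) :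
    ¬ IsStrictlySingular T := by
  intro hS
  obtain ⟨hker, hran⟩ := hT
  set N : Submodule ℝ X := LinearMap.ker (T : X →ₗ[ℝ] Y) with hN
  -- On a closed complement of the kernel `T` is injective with unchanged closed range, so the open
  -- mapping theorem bounds it from below.
  obtain ⟨M, hM, hMN⟩ := (Submodule.ClosedComplemented.of_finiteDimensional N).exists_isClosed_isCompl
  have : CompleteSpace M := hM.completeSpace_coe
  refine hS M (fun hMf => hX ?_) ?_
  · have : FiniteDimensional ℝ (N ⊔ M : Submodule ℝ X) := inferInstance
    rw [hMN.sup_eq_top] at this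
    exact LinearEquiv.finiteDimensional (Submodule.topEquiv (R := ℝ) (M := X))
  · have hinj : Function.Injective (T.domRestrict M) := by
      rw [injective_iff_map_eq_zero]
      intro x hx
      have hxN : (x : X) ∈ N := hx
      exact Subtype.ext (Submodule.disjoint_def.1 hMN.disjoint x hxN x.2)
    have hrange : Set.range (T.domRestrict M) = Set.range T := by
      refine Set.Subset.antisymm ?_ ?_
      · rintro _ ⟨x, rfl⟩
        exact ⟨x, rfl⟩
      · rintro _ ⟨x, rfl⟩
        obtain ⟨n, hn, m, hm, rfl⟩ :=
          Submodule.mem_sup.1 (hMN.sup_eq_top ▸ Submodule.mem_top : x ∈ N ⊔ M)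
        refine ⟨⟨m, hm⟩, ?_⟩
        have : T n = 0 := hn
        rw [map_add, this, zero_add]
        rfl
    obtain ⟨K, hK⟩ := (T.domRestrict M).antilipschitz_of_injective_of_isClosed_range hinj
      (hrange ▸ hran)
    have hK0 : (0 : ℝ) < K + 1 := by positivity
    refine ⟨(K + 1 : ℝ)⁻¹, inv_pos.2 hK0, fun x => ?_⟩
    rw [inv_mul_le_iff₀ hK0]
    have := hK.le_mul_dist x 0
    simp only [dist_zero_right, map_zero] at this
    nlinarith [norm_nonneg (T.domRestrict M x)]

theorem isCompactOperator_smulRight (a : X →L[ℝ] ℝ) (y : Y) :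
    IsCompactOperator (a.smulRight y) := by
  have h : IsCompactOperator (a : X → ℝ) := isCompactOperator_of_locallyCompactSpace_dom a
  exact h.continuous_comp (g := fun t : ℝ => t • y) (by fun_prop)

/-- A nuclear operator with prescribed values on a biorthogonal sequence. -/
theorem exists_isCompactOperator_apply_eq [CompleteSpace Y] {f : ℕ → X} {a : ℕ → X →L[ℝ] ℝ}
    (haf : ∀ n, a n (f n) = 1) (ha : ∀ m n, m ≠ n → a m (f n) = 0) {v : ℕ → Y} {u : ℕ → ℝ} {δ : ℝ}
    (hu : HasSum u δ) (hav : ∀ n, ‖a n‖ * ‖v n‖ ≤ u n) :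
    ∃ K : X →L[ℝ] Y, IsCompactOperator K ∧ ‖K‖ ≤ δ ∧ ∀ n, K (f n) = v n := by
  have hbd : ∀ n, ‖(a n).smulRight (v n)‖ ≤ u n := fun n => by
    rw [ContinuousLinearMap.norm_smulRight_apply]; exact hav n
  have hsum : Summable fun n => (a n).smulRight (v n) :=
    Summable.of_norm_bounded hu.summable hbd
  refine ⟨∑' n, (a n).smulRight (v n), ?_, tsum_of_norm_bounded hu hbd, fun n => ?_⟩
  · refine isCompactOperator_of_tendsto hsum.hasSum (Filter.Eventually.of_forall fun s => ?_)
    induction s using Finset.cons_induction with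
    | empty => simpa using isCompactOperator_zero
    | cons i s hi h =>
      rw [Finset.sum_cons]
      exact (isCompactOperator_smulRight _ _).add h
  · have h1 : HasSum (fun k => (a k).smulRight (v k) (f n))
        ((∑' k, (a k).smulRight (v k)) (f n)) :=
      hsum.hasSum.mapL (ContinuousLinearMap.apply ℝ Y (f n))
    refine h1.unique ?_
    convert hasSum_single n (f := fun k => (a k).smulRight (v k) (f n)) ?_ using 1
    · simp [haf]
    · intro k hk
      simp [ha k n hk]

theorem not_finiteDimensional_of_biorthogonal {ι : Type*} [Infinite ι] {f : ι → X}
    {a : ι → X →L[ℝ] ℝ} (haf : ∀ n, a n (f n) = 1) (ha : ∀ m n, m ≠ n → a m (f n) = 0)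
    {H : Submodule ℝ X} (hH : ∀ n, f n ∈ H) : ¬ FiniteDimensional ℝ H := by
  intro hfin
  have hli : LinearIndependent ℝ f :=
    LinearIndependent.of_pairwise_dual_eq_zero_one f (fun n => (a n : X →ₗ[ℝ] ℝ))
      (fun m n h => ha m n h) haf
  have hli' : LinearIndependent ℝ fun n => (⟨f n, hH n⟩ : H) :=
    LinearIndependent.of_comp H.subtype hli
  exact Infinite.not_finite (α := ι) hli'.finite

/-- Hahn–Banach in `X ⧸ W`: the class of `x` has norm at least `r`, and its norming functional is
pulled back and rescaled. -/
theorem exists_dual_eq_one_of_le_norm_sub {W : Submodule ℝ X} {x : X} {r : ℝ} (hr : 0 < r)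
    (h : ∀ w ∈ W, r ≤ ‖x - w‖) : ∃ a : X →L[ℝ] ℝ, a x = 1 ∧ (∀ w ∈ W, a w = 0) ∧ ‖a‖ ≤ r⁻¹ := by
  have hq : r ≤ ‖W.mkQL x‖ := by
    change r ≤ ‖(QuotientAddGroup.mk x : X ⧸ W.toAddSubgroup)‖
    rw [QuotientAddGroup.norm_mk]
    refine (Metric.le_infDist (s := (W : Set X)) ⟨0, W.zero_mem⟩).2 ?_
    intro w hw
    rw [dist_eq_norm]
    exact h w hw
  have hq0 : 0 < ‖W.mkQL x‖ := hr.trans_le hq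
  obtain ⟨g, hg, hgx⟩ := exists_dual_vector ℝ (W.mkQL x) hq0.ne'
  refine ⟨‖W.mkQL x‖⁻¹ • g.comp W.mkQL, ?_, fun w hw => ?_, ?_⟩
  · simp only [smul_apply, ContinuousLinearMap.comp_apply, hgx]
    exact inv_mul_cancel₀ hq0.ne'
  · have : W.mkQL w = 0 := (Submodule.Quotient.mk_eq_zero W).2 hw
    simp only [smul_apply, ContinuousLinearMap.comp_apply, this, map_zero,
      smul_zero]
  · have hcomp : ‖g.comp W.mkQL‖ ≤ 1 := by
      refine ContinuousLinearMap.opNorm_le_bound _ zero_le_one fun y => ?_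
      calc ‖g (W.mkQL y)‖ ≤ ‖g‖ * ‖W.mkQL y‖ := g.le_opNorm _
        _ = ‖W.mkQL y‖ := by rw [hg, one_mul]
        _ ≤ 1 * ‖y‖ := by rw [one_mul]; exact Submodule.Quotient.norm_mk_le W y
    rw [norm_smul, norm_inv, norm_norm]
    calc ‖W.mkQL x‖⁻¹ * ‖g.comp W.mkQL‖ ≤ r⁻¹ * 1 := by gcongr
      _ = r⁻¹ := mul_one _

end Operators

/-! ### Compact restrictions of operators that are not upper semi-Fredholm -/

section NotUpperSemiFredholm

variable {X Y : Type*} [NormedAddCommGroup X] [NormedSpace ℝ X]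
  [NormedAddCommGroup Y] [NormedSpace ℝ Y]

/-- An operator that is not upper semi-Fredholm is arbitrarily small at unit vectors annihilated by
prescribed functionals. -/
theorem exists_norm_eq_one_of_not_isUpperSemiFredholm [CompleteSpace X] {T : X →L[ℝ] Y} {H : Submodule ℝ X}
    (hH : IsClosed (H : Set X)) (hT : ¬ IsUpperSemiFredholm (T.domRestrict H)) {ι : Type*}
    [Finite ι] (φ : ι → X →L[ℝ] ℝ) {ε : ℝ} (hε : 0 < ε) :
    ∃ x ∈ H, ‖x‖ = 1 ∧ (∀ i, φ i x = 0) ∧ ‖T x‖ < ε := by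
  cases nonempty_fintype ι
  set Φ : X →L[ℝ] (ι → ℝ) := ContinuousLinearMap.pi φ with hΦ
  set N : Submodule ℝ X := LinearMap.ker (Φ : X →ₗ[ℝ] (ι → ℝ)) with hN
  have hNc : IsClosed (N : Set X) := Φ.isClosed_ker
  set L : H →ₗ[ℝ] (ι → ℝ) := (Φ : X →ₗ[ℝ] (ι → ℝ)).comp H.subtype with hL
  -- `H ⊓ N` has finite codimension in `H`, so a lower bound there would make `T` upper
  -- semi-Fredholm on `H`.
  obtain ⟨V, hV⟩ := Submodule.exists_isCompl (LinearMap.ker L)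
  have hVf : FiniteDimensional ℝ V := by
    have : FiniteDimensional ℝ (H ⧸ LinearMap.ker L) :=
      LinearEquiv.finiteDimensional L.quotKerEquivRange.symm
    exact LinearEquiv.finiteDimensional (Submodule.quotientEquivOfIsCompl _ _ hV)
  have hsup : H = V.map H.subtype ⊔ (H ⊓ N) := by
    refine le_antisymm (fun x hx => ?_) (sup_le (Submodule.map_subtype_le _ _) inf_le_left)
    obtain ⟨k, hk, v, hv, hkv⟩ := Submodule.mem_sup.1
      (hV.sup_eq_top ▸ Submodule.mem_top : (⟨x, hx⟩ : H) ∈ LinearMap.ker L ⊔ V)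
    refine Submodule.mem_sup.2 ⟨v, ⟨v, hv, rfl⟩, k, ⟨k.2, hk⟩, ?_⟩
    rw [add_comm]
    exact congrArg Subtype.val hkv
  obtain ⟨x, hx, hx1, hTx⟩ := exists_norm_eq_one_of_not_isBoundedFromBelow
    (fun h => hT (isUpperSemiFredholm_of_eq_sup (hH.inter hNc) hsup h)) hε
  exact ⟨x, hx.1, hx1, fun i => congrFun (show Φ x = 0 from hx.2) i, hTx⟩

/-- The biorthogonal functionals obtained from a triangular system `φ i (x i) = 1`,
`φ i (x j) = 0` for `i < j`. -/
noncomputable def triangularCoord (x : ℕ → X) (φ : ℕ → X →L[ℝ] ℝ) : ℕ → X →L[ℝ] ℝ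
  | n => φ n - ∑ i : Fin n, φ n (x i) • triangularCoord x φ i

theorem triangularCoord_eq (x : ℕ → X) (φ : ℕ → X →L[ℝ] ℝ) (n : ℕ) :
    triangularCoord x φ n = φ n - ∑ i ∈ Finset.range n, φ n (x i) • triangularCoord x φ i := by
  rw [triangularCoord, Finset.sum_range]

/-- Gaussian elimination: at `x m` with `m ≥ n` the subtracted terms vanish by induction; for `m <
n` only the term `i = m` survives, and it cancels `φ n (x m)`. -/
theorem triangularCoord_apply {x : ℕ → X} {φ : ℕ → X →L[ℝ] ℝ} (h1 : ∀ n, φ n (x n) = 1)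
    (h0 : ∀ i j, i < j → φ i (x j) = 0) (n : ℕ) :
    triangularCoord x φ n (x n) = 1 ∧ ∀ m, n ≠ m → triangularCoord x φ n (x m) = 0 := by
  induction n using Nat.strong_induction_on with
  | _ n ih =>
    have happ : ∀ m, triangularCoord x φ n (x m) =
        φ n (x m) - ∑ i ∈ Finset.range n, φ n (x i) * triangularCoord x φ i (x m) := fun m => by
      rw [triangularCoord_eq]
      simp
    have hge : ∀ m, n ≤ m →
        ∑ i ∈ Finset.range n, φ n (x i) * triangularCoord x φ i (x m) = 0 := fun m hm =>
      Finset.sum_eq_zero fun i hi => by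
        have hin := Finset.mem_range.1 hi
        rw [(ih i hin).2 m (by omega), mul_zero]
    refine ⟨by rw [happ, hge n le_rfl, h1, sub_zero], fun m hm => ?_⟩
    rcases lt_or_gt_of_ne hm with h | h
    · rw [happ, hge m h.le, h0 n m h, sub_zero]
    · rw [happ, Finset.sum_eq_single m, (ih m h).1, mul_one, sub_self]
      · intro i hi him
        rw [(ih i (Finset.mem_range.1 hi)).2 m him, mul_zero]
      · exact fun hm' => absurd (Finset.mem_range.2 h) hm'

theorem norm_triangularCoord_le {x : ℕ → X} {φ : ℕ → X →L[ℝ] ℝ} (hx : ∀ n, ‖x n‖ = 1)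
    (hφ : ∀ n, ‖φ n‖ = 1) (n : ℕ) : ‖triangularCoord x φ n‖ ≤ 2 ^ n := by
  induction n using Nat.strong_induction_on with
  | _ n ih =>
    rw [triangularCoord_eq]
    have hsum : ‖∑ i ∈ Finset.range n, φ n (x i) • triangularCoord x φ i‖ ≤
        ∑ i ∈ Finset.range n, (2 : ℝ) ^ i := by
      refine norm_sum_le_of_le _ fun i hi => ?_
      rw [norm_smul]
      have h1 : ‖φ n (x i)‖ ≤ 1 := by
        simpa [hx, hφ] using (φ n).le_opNorm (x i)
      calc ‖φ n (x i)‖ * ‖triangularCoord x φ i‖ ≤ 1 * 2 ^ i := by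
            gcongr
            exact ih i (Finset.mem_range.1 hi)
        _ = 2 ^ i := one_mul _
    calc _ ≤ ‖φ n‖ + ‖∑ i ∈ Finset.range n, φ n (x i) • triangularCoord x φ i‖ := norm_sub_le _ _
      _ ≤ 1 + ∑ i ∈ Finset.range n, (2 : ℝ) ^ i := by rw [hφ]; gcongr
      _ = 2 ^ n := by rw [geom_sum_eq (by norm_num)]; ring

/-- An operator that is not upper semi-Fredholm has a compact restriction to some
infinite-dimensional subspace. -/
theorem exists_isCompactOperator_of_not_isUpperSemiFredholm [CompleteSpace X] [CompleteSpace Y]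
    {T : X →L[ℝ] Y} {H : Submodule ℝ X} (hH : IsClosed (H : Set X))
    (hT : ¬ IsUpperSemiFredholm (T.domRestrict H)) :
    ∃ G ≤ H, ¬ FiniteDimensional ℝ G ∧ IsCompactOperator (T.domRestrict G) := by
  -- Each triple holds a counter, a unit vector killed by all earlier functionals, and its norming
  -- functional. The strictly increasing counter bounds the position from above, which gives the
  -- decay `(1 / 4) ^ n`; this beats the growth `2 ^ n` of the coordinates.
  obtain ⟨p, hp, hpr⟩ := exists_seq_of_forall_finset_exists (α := ℕ × X × (X →L[ℝ] ℝ))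
    (fun p => p.2.1 ∈ H ∧ ‖p.2.1‖ = 1 ∧ ‖T p.2.1‖ < (1 / 4) ^ p.1 ∧ ‖p.2.2‖ = 1 ∧ p.2.2 p.2.1 = 1)
    (fun p q => p.1 < q.1 ∧ p.2.2 q.2.1 = 0) (fun s _ => by
      obtain ⟨x, hxH, hx1, hφ, hTx⟩ := exists_norm_eq_one_of_not_isUpperSemiFredholm hH hT
        (fun q : s => q.1.2.2) (ε := (1 / 4) ^ (s.sup Prod.fst + 1)) (by positivity)
      obtain ⟨g, hg, hgx⟩ := exists_dual_vector ℝ x (by rw [hx1]; exact one_ne_zero)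
      refine ⟨(s.sup Prod.fst + 1, x, g), ⟨hxH, hx1, hTx, hg, by simpa [hx1] using hgx⟩, ?_⟩
      exact fun q hq => ⟨Nat.lt_succ_of_le (Finset.le_sup (f := Prod.fst) hq), hφ ⟨q, hq⟩⟩)
  set x : ℕ → X := fun n => (p n).2.1
  set φ : ℕ → X →L[ℝ] ℝ := fun n => (p n).2.2
  have hid : StrictMono fun n => (p n).1 := fun m n h => (hpr m n h).1
  have hTx : ∀ n, ‖T (x n)‖ ≤ (1 / 4) ^ n := fun n =>
    (hp n).2.2.1.le.trans (pow_le_pow_of_le_one (by norm_num) (by norm_num) (hid.id_le n))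
  have hcoord := triangularCoord_apply (x := x) (φ := φ) (fun n => (hp n).2.2.2.2)
    fun i j h => (hpr i j h).2
  have hnorm := norm_triangularCoord_le (x := x) (φ := φ) (fun n => (hp n).2.1)
    fun n => (hp n).2.2.2.1
  obtain ⟨K, hK, -, hKx⟩ := exists_isCompactOperator_apply_eq (Y := Y) (v := fun n => T (x n))
    (fun n => (hcoord n).1) (fun n => (hcoord n).2) hasSum_geometric_two fun n => by
      calc ‖triangularCoord x φ n‖ * ‖T (x n)‖ ≤ 2 ^ n * (1 / 4) ^ n := by
            gcongr
            exacts [hnorm n, hTx n]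
        _ = (1 / 2) ^ n := by rw [← mul_pow]; norm_num
  refine ⟨Submodule.span ℝ (Set.range x), Submodule.span_le.2 ?_,
    not_finiteDimensional_of_biorthogonal (fun n => (hcoord n).1) (fun n => (hcoord n).2)
      fun n => Submodule.subset_span ⟨n, rfl⟩, ?_⟩
  · rintro _ ⟨n, rfl⟩
    exact (hp n).1
  · have heq : Set.EqOn (T : X →ₗ[ℝ] Y) (K : X →ₗ[ℝ] Y)
        (Submodule.span ℝ (Set.range x)) := LinearMap.eqOn_span (by
      rintro _ ⟨n, rfl⟩
      exact (hKx n).symm)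
    exact hK.domRestrict_of_eqOn fun y hy => (heq hy).symm

end NotUpperSemiFredholm

/-! ### Disjoint and almost disjoint sequences in normed lattices -/

section NormedLattice

theorem IsDisjointSeq.isAlmostDisjointSeq {F : Type*} [NormedAddCommGroup F] [Lattice F] {f : ℕ → F}
    (hf : IsDisjointSeq f) (h1 : ∀ n, ‖f n‖ = 1) : IsAlmostDisjointSeq f :=
  ⟨h1, f, hf, by simp⟩

theorem exists_half_le_norm_of_tendsto_norm_sub {F : Type*} [NormedAddCommGroup F] {e f : ℕ → F}
    (he : ∀ n, ‖e n‖ = 1)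
    (hfe : Filter.Tendsto (fun n => ‖f n - e n‖) Filter.atTop (nhds 0)) :
    ∃ N, ∀ n, N ≤ n → 1 / 2 ≤ ‖f n‖ := by
  obtain ⟨N, hN⟩ := Filter.eventually_atTop.1 (hfe.eventually_lt_const (one_half_pos (α := ℝ)))
  refine ⟨N, fun n hn => ?_⟩
  have h1 := hN n hn
  have h2 := norm_sub_norm_le (e n) (f n)
  rw [norm_sub_rev, he] at h2
  linarith

variable {F : Type*} [NormedAddCommGroup F] [NormedSpace ℝ F] [Lattice F]
  [IsOrderedAddMonoid F] [IsOrderedModule ℝ F]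

/-- Unit vectors in the closed spans of the tails of a disjoint sequence form, for a suitable
choice, an almost disjoint sequence. -/
theorem IsDisjointSeq.exists_isAlmostDisjointSeq {f : ℕ → F} (hf : IsDisjointSeq f)
    (P : ℕ → F → Prop)
    (h : ∀ m k, ∃ x ∈ closedSpan (f '' {n | m ≤ n}), ‖x‖ = 1 ∧ P k x) :
    ∃ x : ℕ → F, IsAlmostDisjointSeq x ∧ ∀ k, P k (x k) := by
  obtain ⟨y, hy, hQ⟩ := hf.exists_block
    (fun k y => ∃ x, ‖x‖ = 1 ∧ P k x ∧ ‖y - x‖ < 1 / ((k : ℝ) + 1)) fun m k => by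
      obtain ⟨x, hx, hx1, hP⟩ := h m k
      obtain ⟨m', hm, y, hy, hyx⟩ :=
        exists_mem_span_image_Ico_norm_sub_lt hx (ε := 1 / ((k : ℝ) + 1)) (by positivity)
      exact ⟨m', hm, y, hy, x, hx1, hP, hyx⟩
  choose x hx1 hP hyx using hQ
  exact ⟨x, ⟨hx1, y, hy, squeeze_zero (fun _ => norm_nonneg _) (fun k => (hyx k).le)
    tendsto_one_div_add_atTop_nhds_zero_nat⟩, hP⟩

/-- The closed span of a disjoint sequence is anti-dispersed. -/
theorem IsDisjointSeq.isAntiDispersed_closedSpan {f : ℕ → F} (hf : IsDisjointSeq f) :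
    IsAntiDispersed (closedSpan (Set.range f)) := by
  intro G hG hGf hdisp
  obtain ⟨x, hx, hxG⟩ := hf.exists_isAlmostDisjointSeq (fun _ x => x ∈ G) fun m _ => by
    have : FiniteDimensional ℝ (Submodule.span ℝ (f '' {n | n < m})) :=
      FiniteDimensional.span_of_finite ℝ ((Set.finite_lt_nat m).image f)
    -- Each tail's closed span, together with a finite-dimensional space, contains `G`, so `G` meets
    -- it nontrivially.
    obtain ⟨x, hxG, hxW, hx⟩ := exists_ne_zero_mem_inf hGf (closedSpan_range_eq_sup f m ▸ hG)
    exact ⟨‖x‖⁻¹ • x, Submodule.smul_mem _ _ hxW, norm_smul_inv_norm hx, G.smul_mem _ hxG⟩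
  exact hdisp ⟨x, hx, hxG⟩

/-- An almost disjoint sequence which is null for `‖T ·‖` yields a normalized disjoint one. -/
theorem IsAlmostDisjointSeq.exists_isDisjointSeq {E : Type*} [NormedAddCommGroup E]
    [NormedSpace ℝ E] {T : F →L[ℝ] E} {e : ℕ → F}
    (he : IsAlmostDisjointSeq e)
    (hT : Filter.Tendsto (fun n => ‖T (e n)‖) Filter.atTop (nhds 0)) :
    ∃ f : ℕ → F, IsDisjointSeq f ∧ (∀ n, ‖f n‖ = 1) ∧
      Filter.Tendsto (fun n => ‖T (f n)‖) Filter.atTop (nhds 0) := by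
  obtain ⟨he1, f, hf, hfe⟩ := he
  obtain ⟨N, hN⟩ := exists_half_le_norm_of_tendsto_norm_sub he1 hfe
  have hN' : ∀ n, 1 / 2 ≤ ‖f (n + N)‖ := fun n => hN _ (Nat.le_add_left _ _)
  -- Past `N` the norms are at least `1 / 2`, so normalizing costs at most a factor 2.
  refine ⟨fun n => ‖f (n + N)‖⁻¹ • f (n + N),
    (hf.comp_injective (add_left_injective N)).smul fun n => ‖f (n + N)‖⁻¹, fun n => ?_, ?_⟩
  · exact norm_smul_inv_norm (norm_pos_iff.1 (one_half_pos.trans_le (hN' n)))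
  · have hlim : Filter.Tendsto (fun n => 2 * (‖T‖ * ‖f (n + N) - e (n + N)‖ + ‖T (e (n + N))‖))
        Filter.atTop (nhds 0) := by
      have := ((hfe.const_mul ‖T‖).add hT).const_mul 2
      simp only [mul_zero, add_zero] at this
      exact this.comp (Filter.tendsto_add_atTop_nat N)
    refine squeeze_zero (fun _ => norm_nonneg _) (fun n => ?_) hlim
    have h2 : ‖f (n + N)‖⁻¹ ≤ 2 := by
      rw [inv_le_comm₀ (one_half_pos.trans_le (hN' n)) two_pos]
      simpa using hN' n
    have h3 : ‖T (f (n + N))‖ ≤ ‖T‖ * ‖f (n + N) - e (n + N)‖ + ‖T (e (n + N))‖ := by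
      calc ‖T (f (n + N))‖ = ‖T (f (n + N) - e (n + N)) + T (e (n + N))‖ := by
            rw [← map_add, sub_add_cancel]
        _ ≤ _ := (norm_add_le _ _).trans (by gcongr; exact T.le_opNorm _)
    rw [map_smul, norm_smul, norm_inv, norm_norm]
    gcongr

variable [HasSolidNorm F]

/-- Biorthogonal functionals of a disjoint sequence. -/
theorem IsDisjointSeq.exists_dual {f : ℕ → F} (hf : IsDisjointSeq f) {n : ℕ} (hn : f n ≠ 0) :
    ∃ a : F →L[ℝ] ℝ, a (f n) = 1 ∧ (∀ m, n ≠ m → a (f m) = 0) ∧ ‖a‖ ≤ ‖f n‖⁻¹ := by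
  obtain ⟨a, ha1, ha0, ha⟩ := exists_dual_eq_one_of_le_norm_sub
    (W := Submodule.span ℝ (f '' {m | n ≠ m})) (norm_pos_iff.2 hn) fun w hw => by
      refine norm_le_norm_of_abs_le_abs ?_
      rw [sub_eq_add_neg]
      refine abs_le_abs_add_of_disjoint (hf.inf_abs_eq_zero_of_mem_span (A := {n})
        (B := {m | n ≠ m}) ?_ (Submodule.subset_span ⟨n, rfl, rfl⟩) (Submodule.neg_mem _ hw))
      simp
  exact ⟨a, ha1, fun m hm => ha0 _ (Submodule.subset_span ⟨m, hm, rfl⟩), ha⟩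

theorem IsDisjointSeq.not_finiteDimensional {f : ℕ → F} (hf : IsDisjointSeq f)
    (hinf : {n | f n ≠ 0}.Infinite) {H : Submodule ℝ F} (hH : ∀ n, f n ∈ H) :
    ¬ FiniteDimensional ℝ H := by
  have : Infinite {n | f n ≠ 0} := hinf.to_subtype
  choose a ha1 ha0 _ using fun n : {n | f n ≠ 0} => hf.exists_dual n.2
  exact not_finiteDimensional_of_biorthogonal (f := fun n : {n | f n ≠ 0} => f n) ha1
    (fun m n h => ha0 m n fun h' => h (Subtype.ext h')) fun n => hH n

variable {E : Type*} [NormedAddCommGroup E] [NormedSpace ℝ E]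

/-- An operator which is null along a normalized disjoint sequence agrees with a compact operator
on a subsequence. -/
theorem IsDisjointSeq.exists_isCompactOperator [CompleteSpace E] {T : F →L[ℝ] E} {f : ℕ → F}
    (hf : IsDisjointSeq f) (h1 : ∀ n, ‖f n‖ = 1)
    (hT : Filter.Tendsto (fun n => ‖T (f n)‖) Filter.atTop (nhds 0)) :
    ∃ φ : ℕ → ℕ, StrictMono φ ∧ ∃ S : F →L[ℝ] E, IsCompactOperator S ∧
      ∀ n, S (f (φ n)) = T (f (φ n)) := by
  obtain ⟨φ, hφ, hφT⟩ := Filter.extraction_forall_of_eventually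
    (P := fun n k => ‖T (f k)‖ < (1 / 2) ^ n) fun n => hT.eventually_lt_const (by positivity)
  have hf0 : ∀ n, f n ≠ 0 := fun n => norm_ne_zero_iff.1 (by rw [h1]; exact one_ne_zero)
  choose a ha1 ha0 ha using fun n => hf.exists_dual (hf0 (φ n))
  obtain ⟨S, hS, -, hSf⟩ := exists_isCompactOperator_apply_eq (f := f ∘ φ) (a := a) ha1
    (fun m n h => ha0 m _ (hφ.injective.ne h)) (v := fun n => T (f (φ n))) hasSum_geometric_two
    fun n => by
      have := ha n
      rw [h1, inv_one] at this
      calc ‖a n‖ * ‖T (f (φ n))‖ ≤ 1 * (1 / 2) ^ n := by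
            gcongr
            exact (hφT n).le
        _ = _ := one_mul _
  exact ⟨φ, hφ, S, hS, hSf⟩

/-- If `T` is bounded from below on a tail of every disjoint sequence, then its restrictions to
non-dispersed subspaces are not strictly singular. -/
theorem not_isStrictlySingular_of_not_isDispersed [CompleteSpace F] {T : F →L[ℝ] E}
    (hT : ∀ f : ℕ → F, IsDisjointSeq f →
      ∃ m : ℕ, IsBoundedFromBelow (T.domRestrict (closedSpan (f '' {n | m ≤ n}))))
    {H : Submodule ℝ F} (hH : ¬ IsDispersed H) : ¬ IsStrictlySingular (T.domRestrict H) := by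
  intro hS
  obtain ⟨e, ⟨he1, f, hf, hfe⟩, heH⟩ := not_not.1 hH
  obtain ⟨N, hN⟩ := exists_half_le_norm_of_tendsto_norm_sub he1 hfe
  obtain ⟨m, c, hc, hcT⟩ := hT f hf
  set δ : ℝ := min (1 / 2) (c / (2 * (‖T‖ + 1))) with hδ
  have hT0 := norm_nonneg T
  have hδ0 : 0 < δ := by positivity
  have hδ1 : δ ≤ 1 / 2 := min_le_left _ _
  have hδT : ‖T‖ * δ ≤ c / 2 := by
    calc ‖T‖ * δ ≤ (‖T‖ + 1) * (c / (2 * (‖T‖ + 1))) := by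
          gcongr
          · linarith
          · exact min_le_right _ _
      _ = c / 2 := by field_simp
  -- With `‖a n‖ ≤ 2`, closeness `δ / 4 * (1 / 2) ^ n` makes the nuclear series sum to at most `δ`.
  obtain ⟨φ, hφ, hφP⟩ := Filter.extraction_forall_of_eventually
    (P := fun n k => (N ≤ k ∧ m ≤ k) ∧ ‖f k - e k‖ < δ / 4 * (1 / 2) ^ n) fun n =>
      ((Filter.eventually_ge_atTop N).and (Filter.eventually_ge_atTop m)).and
        (hfe.eventually_lt_const (by positivity))
  have hφN : ∀ n, 1 / 2 ≤ ‖f (φ n)‖ := fun n => hN _ (hφP n).1.1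
  have hφ0 : ∀ n, f (φ n) ≠ 0 := fun n => norm_pos_iff.1 (one_half_pos.trans_le (hφN n))
  choose a ha1 ha0 ha using fun n => hf.exists_dual (hφ0 n)
  obtain ⟨K, -, hKδ, hK⟩ := exists_isCompactOperator_apply_eq (f := f ∘ φ) (a := a) ha1
    (fun m n h => ha0 m _ (hφ.injective.ne h)) (v := fun n => e (φ n) - f (φ n))
    (hasSum_geometric_two.mul_left (δ / 2)) fun n => by
      have h2 : ‖a n‖ ≤ 2 := (ha n).trans <| by
        rw [inv_le_comm₀ (one_half_pos.trans_le (hφN n)) two_pos]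
        simpa using hφN n
      rw [norm_sub_rev]
      calc ‖a n‖ * ‖f (φ n) - e (φ n)‖ ≤ 2 * (δ / 4 * (1 / 2) ^ n) := by
            gcongr
            exact (hφP n).2.le
        _ = δ / 2 * (1 / 2) ^ n := by ring
  rw [div_mul_cancel₀ δ two_ne_zero] at hKδ
  have hKy : ∀ y, ‖K y‖ ≤ δ * ‖y‖ := fun y => K.le_of_opNorm_le hKδ y
  -- `A` sends `f (φ n)` to `e (φ n)`, hence the span of the former into `H`.
  set A : F →ₗ[ℝ] F := LinearMap.id + (K : F →ₗ[ℝ] F) with hA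
  have hAy : ∀ y, A y = y + K y := fun y => rfl
  have hAinj : Function.Injective A := by
    rw [injective_iff_map_eq_zero]
    intro y hy
    rw [hAy, add_eq_zero_iff_eq_neg] at hy
    have h1 := hKy y
    have h2 : ‖y‖ = ‖K y‖ := by rw [← norm_neg (K y), ← hy]
    exact norm_le_zero_iff.1 (by nlinarith [norm_nonneg y])
  set G : Submodule ℝ F := Submodule.span ℝ (Set.range (f ∘ φ)) with hG
  have hGf : ¬ FiniteDimensional ℝ G :=
    (hf.comp_injective hφ.injective).not_finiteDimensional
      (by simpa [hφ0] using Set.infinite_univ) fun n => Submodule.subset_span ⟨n, rfl⟩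
  have hGtail : G ≤ closedSpan (f '' {n | m ≤ n}) := by
    refine Submodule.span_le.2 ?_
    rintro _ ⟨n, rfl⟩
    exact subset_closedSpan _ ⟨φ n, (hφP n).1.2, rfl⟩
  have hAG : G.map A ≤ H := by
    rw [hG, Submodule.map_span, Submodule.span_le]
    rintro _ ⟨_, ⟨n, rfl⟩, rfl⟩
    rw [hAy, hK]
    simpa using heH (φ n)
  -- The bound is `‖T (A y)‖ ≥ c‖y‖ - (c / 2)‖y‖ ≥ (c / 4)‖A y‖`, since `‖A y‖ ≤ 2‖y‖`.
  have hfin := hS.finiteDimensional_of_le hAG ⟨c / 4, by positivity, by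
    rintro ⟨_, y, hy, rfl⟩
    change c / 4 * ‖A y‖ ≤ ‖T (A y)‖
    have h1 : c * ‖y‖ ≤ ‖T y‖ := hcT ⟨y, hGtail hy⟩
    have h2 := hKy y
    have h3 : ‖y + K y‖ ≤ ‖y‖ + ‖K y‖ := norm_add_le _ _
    have h4 : ‖T (K y)‖ ≤ c / 2 * ‖y‖ := by
      calc ‖T (K y)‖ ≤ ‖T‖ * (δ * ‖y‖) := T.le_opNorm_of_le h2
        _ = ‖T‖ * δ * ‖y‖ := by ring
        _ ≤ c / 2 * ‖y‖ := by gcongr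
    have h5 : ‖T y‖ ≤ ‖T y + T (K y)‖ + ‖T (K y)‖ := by
      simpa using norm_sub_le (T y + T (K y)) (T (K y))
    have h6 : ‖y + K y‖ ≤ 2 * ‖y‖ := by nlinarith [norm_nonneg y]
    rw [hAy, map_add]
    nlinarith⟩
  exact hGf (LinearEquiv.finiteDimensional (Submodule.equivMapOfInjective A hAinj G).symm)

end NormedLattice

/-! ### The equivalences -/

theorem mainTheorem5 {F : Type*} {E : Type*}
    [NormedAddCommGroup F] [NormedSpace ℝ F] [CompleteSpace F]
    [Lattice F] [IsOrderedAddMonoid F] [IsOrderedModule ℝ F] [HasSolidNorm F]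
    [NormedAddCommGroup E] [NormedSpace ℝ E] [CompleteSpace E]
    (T : F →L[ℝ] E) :
    List.TFAE [
      -- no normalized disjoint sequence is null for the seminorm `‖T ·‖`
      ¬ ∃ f : ℕ → F, IsDisjointSeq f ∧ (∀ n, ‖f n‖ = 1) ∧
        Filter.Tendsto (fun n => ‖T (f n)‖) Filter.atTop (nhds 0),
      -- no almost disjoint sequence is null for the seminorm `‖T ·‖`
      ¬ ∃ f : ℕ → F, IsAlmostDisjointSeq f ∧
        Filter.Tendsto (fun n => ‖T (f n)‖) Filter.atTop (nhds 0),
      -- no compact restriction to the closed span of a disjoint sequence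
      ∀ f : ℕ → F, IsDisjointSeq f → {n | f n ≠ 0}.Infinite →
        ¬ IsCompactOperator (T.domRestrict (closedSpan (Set.range f))),
      -- no strictly singular restriction to the closed span of a disjoint sequence
      ∀ f : ℕ → F, IsDisjointSeq f → {n | f n ≠ 0}.Infinite →
        ¬ IsStrictlySingular (T.domRestrict (closedSpan (Set.range f))),
      -- restrictions to closed spans of disjoint sequences are upper semi-Fredholm
      ∀ f : ℕ → F, IsDisjointSeq f →
        IsUpperSemiFredholm (T.domRestrict (closedSpan (Set.range f))),
      -- bounded from below on a tail of each disjoint sequence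
      ∀ f : ℕ → F, IsDisjointSeq f →
        ∃ m : ℕ, IsBoundedFromBelow (T.domRestrict (closedSpan (f '' {n | m ≤ n}))),
      -- kernels of compact perturbations are dispersed
      ∀ S : F →L[ℝ] E, IsCompactOperator S →
        IsDispersed (LinearMap.ker ((T - S : F →L[ℝ] E) : F →ₗ[ℝ] E)),
      -- no compact operator coincides with `T` on a non-dispersed subspace
      ¬ ∃ (S : F →L[ℝ] E) (H : Submodule ℝ F), IsCompactOperator S ∧ ¬ IsDispersed H ∧
        ∀ x ∈ H, S x = T x,
      -- restrictions to anti-dispersed closed subspaces are upper semi-Fredholm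
      ∀ H : Submodule ℝ F, IsClosed (H : Set F) → IsAntiDispersed H →
        IsUpperSemiFredholm (T.domRestrict H),
      -- no compact restriction to a non-dispersed subspace
      ∀ H : Submodule ℝ F, ¬ IsDispersed H → ¬ IsCompactOperator (T.domRestrict H),
      -- no strictly singular restriction to a non-dispersed subspace
      ∀ H : Submodule ℝ F, ¬ IsDispersed H → ¬ IsStrictlySingular (T.domRestrict H)] := by
  tfae_have 2 → 1 := by
    rintro h ⟨f, hf, hf1, hT⟩
    exact h ⟨f, hf.isAlmostDisjointSeq hf1, hT⟩
  tfae_have 1 → 2 := by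
    rintro h ⟨e, he, hT⟩
    exact h (he.exists_isDisjointSeq hT)
  tfae_have 2 → 6 := by
    intro h f hf
    by_contra! hne
    obtain ⟨x, hx, hTx⟩ := hf.exists_isAlmostDisjointSeq (fun k x => ‖T x‖ < 1 / ((k : ℝ) + 1))
      fun m k => exists_norm_eq_one_of_not_isBoundedFromBelow (hne m) (by positivity)
    exact h ⟨x, hx, squeeze_zero (fun _ => norm_nonneg _) (fun k => (hTx k).le)
      tendsto_one_div_add_atTop_nhds_zero_nat⟩
  tfae_have 6 → 5 := by
    intro h f hf
    obtain ⟨m, hm⟩ := h f hf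
    have : FiniteDimensional ℝ (Submodule.span ℝ (f '' {n | n < m})) :=
      FiniteDimensional.span_of_finite ℝ ((Set.finite_lt_nat m).image f)
    exact isUpperSemiFredholm_of_eq_sup (isClosed_closedSpan _) (closedSpan_range_eq_sup f m) hm
  tfae_have 5 → 4 := by
    intro h f hf hinf
    have : CompleteSpace (closedSpan (Set.range f)) := (isClosed_closedSpan _).completeSpace_coe
    exact (h f hf).not_isStrictlySingular
      (hf.not_finiteDimensional hinf fun n => subset_closedSpan _ ⟨n, rfl⟩)
  tfae_have 4 → 3 := fun h f hf hinf hc => h f hf hinf hc.isStrictlySingular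
  tfae_have 3 → 1 := by
    rintro h ⟨f, hf, hf1, hT⟩
    obtain ⟨φ, hφ, S, hS, hST⟩ := hf.exists_isCompactOperator hf1 hT
    have hf0 : ∀ n, f n ≠ 0 := fun n => norm_ne_zero_iff.1 (by rw [hf1]; exact one_ne_zero)
    refine h (f ∘ φ) (hf.comp_injective hφ.injective) (by simpa [hf0] using Set.infinite_univ)
      (hS.domRestrict_of_eqOn fun x hx => ?_)
    have hle : closedSpan (Set.range (f ∘ φ)) ≤ LinearMap.eqLocus (S : F →ₗ[ℝ] E) T := by
      refine closedSpan_le (isClosed_eq S.continuous T.continuous) ?_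
      rintro _ ⟨n, rfl⟩
      exact hST n
    exact hle hx
  tfae_have 7 → 8 := by
    rintro h ⟨S, H, hS, hH, hST⟩
    obtain ⟨e, he, heH⟩ := not_not.1 hH
    refine h S hS ⟨e, he, fun n => ?_⟩
    change (T - S) (e n) = 0
    rw [sub_apply, hST _ (heH n), sub_self]
  tfae_have 8 → 7 := by
    intro h S hS
    by_contra hne
    exact h ⟨S, _, hS, hne, fun x hx => (sub_eq_zero.1 (show T x - S x = 0 from hx)).symm⟩
  tfae_have 6 → 11 := fun h H hH => not_isStrictlySingular_of_not_isDispersed h hH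
  tfae_have 11 → 10 := fun h H hH hc => h H hH hc.isStrictlySingular
  tfae_have 10 → 8 := by
    rintro h ⟨S, H, hS, hH, hST⟩
    exact h H hH (hS.domRestrict_of_eqOn hST)
  tfae_have 8 → 1 := by
    rintro h ⟨f, hf, hf1, hT⟩
    obtain ⟨φ, hφ, S, hS, hST⟩ := hf.exists_isCompactOperator hf1 hT
    refine h ⟨S, LinearMap.eqLocus (S : F →ₗ[ℝ] E) T, hS, not_not.2 ⟨f ∘ φ, ?_, hST⟩,
      fun x hx => hx⟩
    exact (hf.comp_injective hφ.injective).isAlmostDisjointSeq fun n => hf1 _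
  tfae_have 10 → 9 := by
    intro h H hH had
    by_contra hne
    obtain ⟨G, hGH, hGf, hG⟩ := exists_isCompactOperator_of_not_isUpperSemiFredholm hH hne
    exact h G (had G hGH hGf) hG
  tfae_have 9 → 5 := fun h f hf => h _ (isClosed_closedSpan _) hf.isAntiDispersed_closedSpan
  tfae_finish
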